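/- **Setting.** Let $A$ and $B$ be non-trivial finite groups and let $(\Gamma_s)_{s\ge 0}$ be a sequence of groups. For every $s$ let $a_s\colon A\to A_s$ and $b_s\colon B\to B_s$ be isomorphisms onto subgroups $A_s,B_s\le\Gamma_s$ such that $A_s\cup B_s$ generates $\Gamma_s$ and $\Gamma_s/[A_s,B_s]^{\Gamma_s}\cong A_s\times B_s$, where $[A_s,B_s]^{\Gamma_s}$ is the normal closure of $[A_s,B_s]$. Let $(k_s)_{s\ge0}$ be non-negative integers with $k_0=0$ and $k_{s+1}>2k_s$ for all $s$. Let $\mathbf G=A*B*\mathbf Z$, let $\tau$ be a generator of the factor $\mathbf Z$, and let $\pi_s\colon\mathbf G\to\Gamma_s\wr\mathbf Z=\Gamma_s^{(\mathbf Z)}\rtimes\mathbf Z$ be the homomorphism with $$\pi_s(a)=(a_s(a)\delta_{-k_s},0),\qquad \pi_s(b)=(b_s(b)\delta_{k_s},0),\qquad \pi_s(\tau)=(1,1)\qquad(a\in A,\ b\in B),$$ where $g\delta_i$ takes the value $g$ at $i$ and is trivial elsewhere. The *lamplighter diagonal product* of $(\Gamma_s,a_s,b_s,k_s)_{s\ge0}$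 is $\Delta=\mathbf G/\bigcap_{s\ge 0}\ker\pi_s$. It is viewed as a graph, namely its Cayley graph with respect to the image of $A\cup B\cup\{\tau^{\pm1}\}$, and its degree is the degree of this graph. For a finite graph $\Gamma$ with at least two vertices and $p\in[1,\infty)$ let $$h_p(\Gamma)=\inf\left\{\frac{\|\nabla f\|_p}{\|f-f_\Gamma\|_p}\ :\ f\colon V\Gamma\to\mathbf R,\ \|f-f_\Gamma\|_p\neq0\right\},\qquad |\nabla f|(g)=\sup_{h,h'\in B(g,1)}|f(h)-f(h')|,\qquad f_\Gamma=\frac1{|V\Gamma|}\sum_{g\in V\Gamma}f(g),$$ and let $h_p(\Gamma)=0$ if $\Gamma$ has at most one vertex. The *$L^p$-Poincaré profile* of a graph $G$ is $$\Pi_{G,p}(N)=\sup\{|V\Gamma|\,h_p(\Gamma)\ :\ \Gamma\text{ a subgraph of }G,\ |V\Gamma|\le N\}.$$ **Theorem.** For every real $m_0\ge2$ and every integer $d\ge 0$ there are constants $c_1,c_2>0$, depending only on $m_0$ and $d$, such that the following holds. Let $\Delta$ be the lamplighter diagonal product of $(\Gamma_s,a_s,b_s,k_s)_{s\ge0}$,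 of degree $d$. Let $l_s=\operatorname{diam}(\Gamma_s)$ be the diameter of the Cayley graph of $\Gamma_s$ with respect to $A_s\cup B_s$, assumed to be finite for every $s$, and assume that $k_{s+1}\ge m_0k_s$ and $l_{s+1}\ge m_0l_s$ for every $s\ge0$. Let $\varrho_\Delta\colon[0,\infty)\to[0,\infty)$ be defined by $$\varrho_\Delta(x)=\begin{cases}x/l_s&\text{if }x\in[k_sl_s,\,k_{s+1}l_s),\\ k_{s+1}&\text{if }x\in[k_{s+1}l_s,\,k_{s+1}l_{s+1}),\end{cases}\qquad s\ge0.$$ Then for every $p\in[1,\infty)$ and every integer $N\ge1$, $$\Pi_{\Delta,p}(N)\ \le\ c_1\,\frac{N}{\varrho_\Delta(c_2\log N)},$$ where for $N=1$ the right-hand side is read as $+\infty$, since $\varrho_\Delta(0)=0$. -/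

import Mathlib

open scoped ENNReal

universe u v w

/-! ## Poincaré profiles of graphs -/

section Poincare

variable {V : Type*}

/-- The gradient at scale one: `|∇f|(g) = sup |f h - f h'|` over `h, h'` in the closed ball
of radius one around `g`, that is, over `h, h'` equal or adjacent to `g`. -/
noncomputable def graphGradient (Γ : SimpleGraph V) (f : V → ℝ) (g : V) : ℝ :=
  sSup {r : ℝ | ∃ h h' : V, (h = g ∨ Γ.Adj g h) ∧ (h' = g ∨ Γ.Adj g h') ∧ r = |f h - f h'|}

/-- The `ℓ^p` norm (for the counting measure) of a function on a finite set. -/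
noncomputable def lpNormFin [Fintype V] (p : ℝ) (u : V → ℝ) : ℝ :=
  (∑ v, |u v| ^ p) ^ (1 / p)

/-- The average of a function on a finite set. -/
noncomputable def averageFin [Fintype V] (f : V → ℝ) : ℝ :=
  (Fintype.card V : ℝ)⁻¹ * ∑ v, f v

/-- The `L^p`-Cheeger constant of a finite graph: the infimum of `‖∇f‖_p / ‖f - f_Γ‖_p` over the
real functions `f` on the vertices with `‖f - f_Γ‖_p ≠ 0`. When there is no such `f` (at most one
vertex) the value is `0`, the usual convention. -/
noncomputable def lpCheeger [Fintype V] (Γ : SimpleGraph V) (p : ℝ) : ℝ :=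
  sInf {r : ℝ | ∃ f : V → ℝ, lpNormFin p (fun v => f v - averageFin f) ≠ 0 ∧
    r = lpNormFin p (graphGradient Γ f) / lpNormFin p (fun v => f v - averageFin f)}

/-- The `L^p`-Poincaré profile of a graph: the supremum of `|VΓ| h_p(Γ)` over the subgraphs `Γ`
with at most `n` vertices. It takes values in `[0, ∞]`, so that it is a genuine supremum. -/
noncomputable def poincareProfile (G : SimpleGraph V) (p : ℝ) (n : ℕ) : ℝ≥0∞ :=
  ⨆ (Γ : G.Subgraph) (hΓ : Γ.verts.Finite) (_ : Γ.verts.ncard ≤ n),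
    letI : Fintype Γ.verts := hΓ.fintype
    ENNReal.ofReal ((Γ.verts.ncard : ℝ) * lpCheeger Γ.coe p)

end Poincare

/-! ## Lamplighter groups over the integers -/

/-- The (restricted) wreath product `Γ ≀ ℤ`: pairs of a finitely supported lamp configuration
and a position of the cursor. -/
@[ext]
structure LampGroup (Γ : Type*) [Group Γ] where
  lamp : ℤ → Γ
  cursor : ℤ
  finite_support : (Function.mulSupport lamp).Finite

namespace LampGroup

variable {Γ : Type*} [Group Γ]

theorem finite_mulSupport_shift {g : ℤ → Γ} (hg : (Function.mulSupport g).Finite) (i : ℤ) :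
    (Function.mulSupport fun x => g (x - i)).Finite := by
  have h : (Function.mulSupport fun x => g (x - i)) = (fun x => x - i) ⁻¹' Function.mulSupport g :=
    rfl
  rw [h]
  exact hg.preimage (fun x _ y _ hxy => by simpa using hxy)

/-- `(f, i) (g, j) = (h, i + j)` with `h x = f x * g (x - i)`. -/
instance : Mul (LampGroup Γ) where
  mul z w :=
    { lamp := fun x => z.lamp x * w.lamp (x - z.cursor)
      cursor := z.cursor + w.cursor
      finite_support :=
        (z.finite_support.union (finite_mulSupport_shift w.finite_support z.cursor)).subset
          (Function.mulSupport_mul _ _) }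

instance : One (LampGroup Γ) where
  one := { lamp := fun _ => 1, cursor := 0, finite_support := by simp }

instance : Inv (LampGroup Γ) where
  inv z :=
    { lamp := fun x => (z.lamp (x + z.cursor))⁻¹
      cursor := -z.cursor
      finite_support := by
        have h := finite_mulSupport_shift z.finite_support (-z.cursor)
        simp only [sub_neg_eq_add] at h
        refine h.subset fun x hx => ?_
        simpa [Function.mem_mulSupport] using hx }

@[simp] theorem mul_lamp (z w : LampGroup Γ) (x : ℤ) :
    (z * w).lamp x = z.lamp x * w.lamp (x - z.cursor) := rfl
@[simp] theorem mul_cursor (z w : LampGroup Γ) : (z * w).cursor = z.cursor + w.cursor := rfl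
@[simp] theorem one_lamp (x : ℤ) : (1 : LampGroup Γ).lamp x = 1 := rfl
@[simp] theorem one_cursor : (1 : LampGroup Γ).cursor = 0 := rfl
@[simp] theorem inv_lamp (z : LampGroup Γ) (x : ℤ) :
    (z⁻¹).lamp x = (z.lamp (x + z.cursor))⁻¹ := rfl
@[simp] theorem inv_cursor (z : LampGroup Γ) : (z⁻¹).cursor = -z.cursor := rfl

instance : Group (LampGroup Γ) :=
  Group.ofLeftAxioms
    (by
      intro u v w
      ext x
      · simp [mul_assoc, sub_sub]
      · simp [add_assoc])
    (by
      intro u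
      ext x <;> simp)
    (by
      intro u
      ext x <;> simp)

/-- The homomorphism `g ↦ (g δ_i, 0)`, where `g δ_i` is `g` at `i` and trivial elsewhere. -/
def dirac (i : ℤ) : Γ →* LampGroup Γ where
  toFun g :=
    { lamp := Pi.mulSingle i g
      cursor := 0
      finite_support := (Set.finite_singleton i).subset Pi.mulSupport_mulSingle_subset }
  map_one' := by
    ext x
    · exact congrFun (Pi.mulSingle_one (M := fun _ : ℤ => Γ) i) x
    · rfl
  map_mul' g h := by
    ext x
    · have := congrFun (Pi.mulSingle_mul (f := fun _ : ℤ => Γ) i g h) x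
      simpa using this
    · simp

/-- The element `(1, 1)`, which moves the cursor by one. -/
def shift : LampGroup Γ where
  lamp := fun _ => 1
  cursor := 1
  finite_support := by simp

end LampGroup

/-! ## Lamplighter diagonal products -/

instance normal_iInf_ker {ι G : Type*} [Group G] {H : ι → Type*} [∀ i, Group (H i)]
    (π : ∀ i, G →* H i) : (⨅ i, (π i).ker).Normal :=
  Subgroup.normal_iInf_normal fun _ => inferInstance

/-- The diagonal product `G / ⋂ ker π_i` of a family of quotients `π i : G →* H i` of `G`. -/
abbrev DiagonalProduct {ι G : Type*} [Group G] {H : ι → Type*} [∀ i, Group (H i)]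
    (π : ∀ i, G →* H i) : Type _ :=
  G ⧸ (⨅ i, (π i).ker)

/-- The data `(Γ_s, a_s, b_s, k_s)` of a lamplighter diagonal product. The subgroups `A_s`, `B_s`
of `Γ_s` are the ranges of the injective homomorphisms `a s`, `b s`. -/
structure LampData (A B : Type*) [Group A] [Group B] (Γ : ℕ → Type*) [∀ s, Group (Γ s)] where
  a : ∀ s, A →* Γ s
  b : ∀ s, B →* Γ s
  k : ℕ → ℕ
  a_injective : ∀ s, Function.Injective (a s)
  b_injective : ∀ s, Function.Injective (b s)
  /-- `A_s ∪ B_s` generates `Γ_s` -/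
  generates : ∀ s, Subgroup.closure (Set.range (a s) ∪ Set.range (b s)) = ⊤
  k_zero : k 0 = 0
  two_mul_lt : ∀ s, 2 * k s < k (s + 1)
  /-- `Γ_s / [A_s, B_s]^{Γ_s}` is isomorphic to `A_s × B_s` -/
  quotient_iso : ∀ s, Nonempty
    ((Γ s ⧸ Subgroup.normalClosure
      ((⁅(a s).range, (b s).range⁆ : Subgroup (Γ s)) : Set (Γ s))) ≃*
        ((a s).range × (b s).range))

namespace LampData

variable {A B : Type*} [Group A] [Group B] {Γ : ℕ → Type*} [∀ s, Group (Γ s)]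

/-- The free product of `A`, `B` and `ℤ`. -/
abbrev FreeProd (A B : Type*) [Group A] [Group B] : Type _ :=
  Monoid.Coprod (Monoid.Coprod A B) (Multiplicative ℤ)

/-- The copy of `A` in the free product. -/
def ofA : A →* FreeProd A B := Monoid.Coprod.inl.comp Monoid.Coprod.inl

/-- The copy of `B` in the free product. -/
def ofB : B →* FreeProd A B := Monoid.Coprod.inl.comp Monoid.Coprod.inr

/-- The generator of the copy of `ℤ` in the free product. -/
def tau : FreeProd A B := Monoid.Coprod.inr (Multiplicative.ofAdd 1)

/-- The homomorphism `π_s` from the free product to `Γ_s ≀ ℤ` given by `a ↦ (a_s(a) δ_{-k_s}, 0)`,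
`b ↦ (b_s(b) δ_{k_s}, 0)` and `τ ↦ (1, 1)`. -/
def proj (D : LampData A B Γ) (s : ℕ) : FreeProd A B →* LampGroup (Γ s) :=
  Monoid.Coprod.lift
    (Monoid.Coprod.lift
      ((LampGroup.dirac (-(D.k s : ℤ))).comp (D.a s))
      ((LampGroup.dirac (D.k s : ℤ)).comp (D.b s)))
    (zpowersHom (LampGroup (Γ s)) LampGroup.shift)

/-- The lamplighter diagonal product `Δ`. -/
abbrev Delta (D : LampData A B Γ) : Type _ := DiagonalProduct D.proj

/-- The canonical projection from the free product to `Δ`. -/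
def toDelta (D : LampData A B Γ) : FreeProd A B →* D.Delta := QuotientGroup.mk' _

/-- The generating set `A ∪ B ∪ {τ, τ⁻¹}` of `Δ`. -/
def genSet (D : LampData A B Γ) : Set D.Delta :=
  D.toDelta '' (Set.range ofA ∪ Set.range ofB ∪ {tau, tau⁻¹})

/-- The Cayley graph of `Δ`. -/
def cayleyGraph (D : LampData A B Γ) : SimpleGraph D.Delta := SimpleGraph.mulCayley D.genSet

/-- The degree of (the Cayley graph of) `Δ`: the number of neighbours of the identity. -/
noncomputable def degree (D : LampData A B Γ) : ℕ := (D.cayleyGraph.neighborSet 1).ncard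

/-- The Cayley graph of `Γ_s` with respect to `A_s ∪ B_s`. -/
def lampCayley (D : LampData A B Γ) (s : ℕ) : SimpleGraph (Γ s) :=
  SimpleGraph.mulCayley (Set.range (D.a s) ∪ Set.range (D.b s))

/-- The diameter `l_s` of `Γ_s` (meaningful when the diameter is finite). -/
noncomputable def l (D : LampData A B Γ) (s : ℕ) : ℕ := (D.lampCayley s).diam

open Classical in
/-- The function equal to `x / l_s` on `[k_s l_s, k_{s+1} l_s)` and to `k_{s+1}` on
`[k_{s+1} l_s, k_{s+1} l_{s+1})`, for every `s`; these intervals are disjoint and cover `[0, ∞)`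
as soon as `k_0 = 0` and `(k_s)`, `(l_s)` increase to infinity. -/
noncomputable def varrho (D : LampData A B Γ) (x : ℝ) : ℝ :=
  if h : ∃ s, x ∈ Set.Ico ((D.k s : ℝ) * D.l s) ((D.k (s + 1) : ℝ) * D.l s) then
    x / D.l h.choose
  else if h : ∃ s, x ∈ Set.Ico ((D.k (s + 1) : ℝ) * D.l s) ((D.k (s + 1) : ℝ) * D.l (s + 1)) then
    D.k (h.choose + 1)
  else 0

theorem k_monotone (D : LampData A B Γ) : Monotone D.k :=
  monotone_nat_of_le_succ fun s => by have := D.two_mul_lt s; omega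

theorem varrho_eq_div (D : LampData A B Γ) (hl : Monotone D.l) {s : ℕ} {x : ℝ}
    (hx : x ∈ Set.Ico ((D.k s : ℝ) * D.l s) ((D.k (s + 1) : ℝ) * D.l s)) :
    D.varrho x = x / D.l s := by
  have key : ∀ i j : ℕ, i < j → (D.k (i + 1) : ℝ) * D.l i ≤ (D.k j : ℝ) * D.l j := by
    intro i j hij
    exact_mod_cast Nat.mul_le_mul (D.k_monotone hij) (hl hij.le)
  have h : ∃ s, x ∈ Set.Ico ((D.k s : ℝ) * D.l s) ((D.k (s + 1) : ℝ) * D.l s) := ⟨s, hx⟩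
  have hc := h.choose_spec
  have e : h.choose = s := by
    rcases lt_trichotomy h.choose s with h1 | h1 | h1
    · linarith [key _ _ h1, hc.2, hx.1]
    · exact h1
    · linarith [key _ _ h1, hx.2, hc.1]
  rw [varrho, dif_pos h, e]

theorem varrho_eq_k (D : LampData A B Γ) (hl : Monotone D.l) {s : ℕ} {x : ℝ}
    (hx : x ∈ Set.Ico ((D.k (s + 1) : ℝ) * D.l s) ((D.k (s + 1) : ℝ) * D.l (s + 1))) :
    D.varrho x = D.k (s + 1) := by
  have mono : ∀ i j i' j' : ℕ, i ≤ i' → j ≤ j' → (D.k i : ℝ) * D.l j ≤ (D.k i' : ℝ) * D.l j' := by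
    intro i j i' j' hi hj
    exact_mod_cast Nat.mul_le_mul (D.k_monotone hi) (hl hj)
  have h1 : ¬ ∃ s, x ∈ Set.Ico ((D.k s : ℝ) * D.l s) ((D.k (s + 1) : ℝ) * D.l s) := by
    rintro ⟨t, ht⟩
    rcases le_or_gt t s with hts | hts
    · linarith [ht.2, hx.1, mono (t + 1) t (s + 1) s (by omega) hts]
    · linarith [ht.1, hx.2, mono (s + 1) (s + 1) t t hts hts]
  have h2 : ∃ s, x ∈ Set.Ico ((D.k (s + 1) : ℝ) * D.l s)
      ((D.k (s + 1) : ℝ) * D.l (s + 1)) := ⟨s, hx⟩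
  have hc := h2.choose_spec
  have e : h2.choose = s := by
    rcases lt_trichotomy h2.choose s with h3 | h3 | h3
    · linarith [hc.2, hx.1, mono (h2.choose + 1) (h2.choose + 1) (s + 1) s (by omega) h3]
    · exact h3
    · linarith [hc.1, hx.2, mono (s + 1) (s + 1) (h2.choose + 1) h2.choose (by omega) h3]
  rw [varrho, dif_neg h1, dif_pos h2, e]

end LampData

/-! ## Upper bounds for Cheeger constants -/

section Cheeger

variable {V : Type*}

/-! A large finite subgraph has a small Cheeger constant as soon as the ambient graph can be cut
into small pieces along thin walls. Take a 1-Lipschitz function that is at most 1 next to the walls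
and large on half of the vertices, keep it on some of the pieces and put zero on the others: the
result is still 1-Lipschitz, and it is far from every constant if both families of pieces carry a
fixed proportion of the mass (`lpCheeger_le_of_label`).

In `Δ` the walls come from the cursor. Divide `ℤ` into blocks of length `2L`; a piece consists of
the elements that can be joined by moving the cursor inside one block and switching lamps there
(`label`). The distance from the cursor to the ends of its block is the required function, and
shifting the subdivision by `L` if necessary makes it at least `L/2` on half of the vertices. This
gives the bound `64 / L` of `lpCheeger_le_of_card`.

The pieces are small because of the diagonal product structure. If `L ≤ k (s+1)`, then at a level
above `s` no lamp can be reached from the block by both `A` and `B`, so its value can be read off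
from level `0` (`mem_iInf_ker_of_forall_le`). Only the levels up to `s` count, and since the
diameters at least double, a piece has at most `exp (C L l_s)` elements when `k s ≤ L`
(`piece_card_le`).

The function `varrho` is, up to a factor 2, the largest `L` for which this size is a small power of
`N` (`exists_scale`). Subgraphs with fewer than `√N` vertices are handled by the universal bound
`lpCheeger_le_twelve`. -/

theorem graphGradient_nonneg (Γ : SimpleGraph V) (f : V → ℝ) (g : V) :
    0 ≤ graphGradient Γ f g := by
  refine Real.sSup_nonneg ?_
  rintro r ⟨h, h', -, -, rfl⟩
  exact abs_nonneg _

theorem graphGradient_le {Γ : SimpleGraph V} {f : V → ℝ} {δ : ℝ}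
    (hf : ∀ v w, Γ.Adj v w → |f v - f w| ≤ δ) (hδ : 0 ≤ δ) (g : V) :
    graphGradient Γ f g ≤ 2 * δ := by
  refine Real.sSup_le ?_ (by positivity)
  rintro r ⟨h, h', hh, hh', rfl⟩
  have key : ∀ x, (x = g ∨ Γ.Adj g x) → |f g - f x| ≤ δ := by
    rintro x (rfl | hx)
    · simpa using hδ
    · exact hf _ _ hx
  have h1 := key h hh
  have h2 := key h' hh'
  rw [abs_le] at h1 h2 ⊢
  constructor <;> linarith [h1.1, h1.2, h2.1, h2.2]

theorem lpNormFin_nonneg [Fintype V] (p : ℝ) (u : V → ℝ) : 0 ≤ lpNormFin p u :=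
  Real.rpow_nonneg (Finset.sum_nonneg fun _ _ => Real.rpow_nonneg (abs_nonneg _) _) _

theorem lpNormFin_le [Fintype V] {p : ℝ} (hp : 1 ≤ p) {u : V → ℝ} {M : ℝ} (hM : 0 ≤ M)
    (hu : ∀ v, |u v| ≤ M) : lpNormFin p u ≤ (Fintype.card V : ℝ) ^ (1 / p) * M := by
  have hp0 : p ≠ 0 := by linarith
  have h : ∑ v, |u v| ^ p ≤ (Fintype.card V : ℝ) * M ^ p := by
    calc ∑ v, |u v| ^ p ≤ ∑ _v : V, M ^ p := Finset.sum_le_sum fun v _ =>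
          Real.rpow_le_rpow (abs_nonneg _) (hu v) (by linarith)
      _ = _ := by simp
  calc lpNormFin p u ≤ ((Fintype.card V : ℝ) * M ^ p) ^ (1 / p) :=
        Real.rpow_le_rpow (Finset.sum_nonneg fun _ _ => Real.rpow_nonneg (abs_nonneg _) _) h
          (by positivity)
    _ = _ := by
        rw [Real.mul_rpow (by positivity) (by positivity), one_div, Real.rpow_rpow_inv hM hp0]

/-- By the power mean inequality an `ℓ^1` lower bound suffices for every `p`. The factor `card ^ (1
/ p)` cancels the one in `lpNormFin_le`, which is why the final constants do not depend on `p`. -/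
theorem le_lpNormFin [Fintype V] [Nonempty V] {p : ℝ} (hp : 1 ≤ p) {u : V → ℝ} {m : ℝ}
    (hm : 0 ≤ m) (hu : Fintype.card V * m ≤ ∑ v, |u v|) :
    (Fintype.card V : ℝ) ^ (1 / p) * m ≤ lpNormFin p u := by
  have hp0 : p ≠ 0 := by linarith
  have hn : (0 : ℝ) < Fintype.card V := by exact_mod_cast Fintype.card_pos
  have h1 : ((Fintype.card V : ℝ) * m) ^ p ≤
      (Fintype.card V : ℝ) ^ (p - 1) * ∑ v, |u v| ^ p :=
    (Real.rpow_le_rpow (by positivity) hu (by linarith)).trans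
      (Real.rpow_sum_le_const_mul_sum_rpow Finset.univ u hp)
  have h2 : (Fintype.card V : ℝ) * m ^ p ≤ ∑ v, |u v| ^ p := by
    rw [Real.mul_rpow hn.le hm, Real.rpow_sub_one hn.ne', div_mul_eq_mul_div, le_div_iff₀ hn,
      mul_assoc] at h1
    have := le_of_mul_le_mul_left h1 (by positivity)
    linarith
  calc (Fintype.card V : ℝ) ^ (1 / p) * m = ((Fintype.card V : ℝ) * m ^ p) ^ (1 / p) := by
        rw [Real.mul_rpow (by positivity) (by positivity), one_div, Real.rpow_rpow_inv hm hp0]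
    _ ≤ _ := Real.rpow_le_rpow (by positivity) h2 (by positivity)

theorem lpCheeger_le_div [Fintype V] [Nonempty V] {Γ : SimpleGraph V} {p : ℝ} (hp : 1 ≤ p)
    {f : V → ℝ} {δ m : ℝ} (hδ : 0 ≤ δ) (hm : 0 < m)
    (hf : ∀ v w, Γ.Adj v w → |f v - f w| ≤ δ)
    (hfm : Fintype.card V * m ≤ ∑ v, |f v - averageFin f|) :
    lpCheeger Γ p ≤ 2 * δ / m := by
  have hn : (0 : ℝ) < Fintype.card V := by exact_mod_cast Fintype.card_pos
  have hlow := le_lpNormFin hp hm.le hfm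
  have hup : lpNormFin p (graphGradient Γ f) ≤ (Fintype.card V : ℝ) ^ (1 / p) * (2 * δ) :=
    lpNormFin_le hp (by positivity) fun v => by
      rw [abs_of_nonneg (graphGradient_nonneg _ _ _)]
      exact graphGradient_le hf hδ v
  have hpos : 0 < (Fintype.card V : ℝ) ^ (1 / p) := by positivity
  have hlow0 : 0 < lpNormFin p (fun v => f v - averageFin f) :=
    lt_of_lt_of_le (by positivity) hlow
  have hle : lpCheeger Γ p ≤
      lpNormFin p (graphGradient Γ f) / lpNormFin p (fun v => f v - averageFin f) := by
    refine csInf_le ⟨0, ?_⟩ ⟨f, hlow0.ne', rfl⟩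
    rintro r ⟨f', -, rfl⟩
    exact div_nonneg (lpNormFin_nonneg _ _) (lpNormFin_nonneg _ _)
  refine hle.trans ?_
  rw [div_le_div_iff₀ hlow0 hm]
  calc _ ≤ (Fintype.card V : ℝ) ^ (1 / p) * (2 * δ) * m := by gcongr
    _ = 2 * δ * ((Fintype.card V : ℝ) ^ (1 / p) * m) := by ring
    _ ≤ _ := by gcongr

/-- Whichever side of `b / 2` the constant `c` lies on, one of the two sets keeps distance at least
`b / 2` from it. -/
theorem card_mul_le_sum_abs_sub [Fintype V] {f : V → ℝ} {S T : Finset V} {θ b c : ℝ}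
    (hb : 0 ≤ b) (hS : θ * Fintype.card V ≤ S.card) (hT : θ * Fintype.card V ≤ T.card)
    (hfS : ∀ v ∈ S, b ≤ f v) (hfT : ∀ v ∈ T, f v ≤ 0) :
    Fintype.card V * (θ * (b / 2)) ≤ ∑ v, |f v - c| := by
  have key : ∀ U : Finset V, θ * Fintype.card V ≤ U.card → (∀ v ∈ U, b / 2 ≤ |f v - c|) →
      Fintype.card V * (θ * (b / 2)) ≤ ∑ v, |f v - c| := by
    intro U hU h
    calc Fintype.card V * (θ * (b / 2)) = θ * Fintype.card V * (b / 2) := by ring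
      _ ≤ U.card * (b / 2) := by gcongr
      _ = ∑ v ∈ U, b / 2 := by simp
      _ ≤ ∑ v ∈ U, |f v - c| := Finset.sum_le_sum h
      _ ≤ _ := Finset.sum_le_sum_of_subset_of_nonneg (Finset.subset_univ _)
          fun _ _ _ => abs_nonneg _
  rcases le_total c (b / 2) with hc | hc
  · exact key S hS fun v hv => le_abs.2 (Or.inl (by linarith [hfS v hv]))
  · exact key T hT fun v hv => le_abs.2 (Or.inr (by linarith [hfT v hv]))

theorem lpCheeger_le_of_separated [Fintype V] [Nonempty V] {Γ : SimpleGraph V} {p : ℝ}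
    (hp : 1 ≤ p) {f : V → ℝ} {S T : Finset V} {θ b : ℝ} (hθ : 0 < θ) (hb : 0 < b)
    (hf : ∀ v w, Γ.Adj v w → |f v - f w| ≤ 1)
    (hS : θ * Fintype.card V ≤ S.card) (hT : θ * Fintype.card V ≤ T.card)
    (hfS : ∀ v ∈ S, b ≤ f v) (hfT : ∀ v ∈ T, f v ≤ 0) :
    lpCheeger Γ p ≤ 4 / (θ * b) := by
  refine (lpCheeger_le_div hp zero_le_one (m := θ * (b / 2)) (by positivity) hf
    (card_mul_le_sum_abs_sub hb.le hS hT hfS hfT)).trans (le_of_eq ?_)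
  field_simp
  norm_num

theorem lpCheeger_le_twelve [Fintype V] (Γ : SimpleGraph V) {p : ℝ} (hp : 1 ≤ p) :
    lpCheeger Γ p ≤ 12 := by
  classical
  rcases subsingleton_or_nontrivial V with hV | hV
  · have : {r : ℝ | ∃ f : V → ℝ, lpNormFin p (fun v => f v - averageFin f) ≠ 0 ∧
        r = lpNormFin p (graphGradient Γ f) / lpNormFin p (fun v => f v - averageFin f)} = ∅ := by
      refine Set.eq_empty_of_forall_notMem ?_
      rintro r ⟨f, hf, -⟩
      apply hf
      have hz : ∀ v, f v - averageFin f = 0 := by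
        intro v
        have hc : Fintype.card V = 1 :=
          le_antisymm (Fintype.card_le_one_iff_subsingleton.2 hV) (Fintype.card_pos_iff.2 ⟨v⟩)
        rw [averageFin, hc, Fintype.sum_subsingleton f v]
        simp
      have hp0 : p ≠ 0 := by linarith
      simp [lpNormFin, hz, Real.zero_rpow hp0, hp0]
    rw [lpCheeger, this, Real.sInf_empty]
    norm_num
  · have hn : 2 ≤ Fintype.card V := Fintype.one_lt_card
    -- The test function is the indicator of half of the vertices. The proportion `1 / 3` rather
    -- than `1 / 2` allows for rounding, the worst case being three vertices.
    obtain ⟨S, -, hS⟩ := Finset.exists_subset_card_eq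
      (s := (Finset.univ : Finset V)) (n := Fintype.card V / 2)
      (by rw [Finset.card_univ]; omega)
    have hSc : Sᶜ.card = Fintype.card V - Fintype.card V / 2 := by rw [Finset.card_compl, hS]
    have h1 : Fintype.card V ≤ 3 * S.card := by omega
    have h2 : Fintype.card V ≤ 3 * Sᶜ.card := by omega
    have h1' : (Fintype.card V : ℝ) ≤ 3 * S.card := by exact_mod_cast h1
    have h2' : (Fintype.card V : ℝ) ≤ 3 * Sᶜ.card := by exact_mod_cast h2
    refine (lpCheeger_le_of_separated hp (f := fun v => if v ∈ S then 1 else 0) (S := S)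
      (T := Sᶜ) (θ := 1 / 3) (b := 1) (by norm_num) one_pos ?_ ?_ ?_ ?_ ?_).trans (by norm_num)
    · intro v w _
      split_ifs <;> norm_num
    · linarith
    · linarith
    · intro v hv
      simp [hv]
    · intro v hv
      simp [Finset.mem_compl.1 hv]

/-- Greedy choice: add elements one at a time until the sum reaches `m`; the last one adds at most
`m`. -/
theorem exists_subset_sum_between {X : Type*} (w : X → ℕ) {m : ℝ} (hm0 : 0 ≤ m) (hm : ∀ x, (w x : ℝ) ≤ m)
    (U : Finset X) (hU : m ≤ ∑ x ∈ U, (w x : ℝ)) :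
    ∃ U' ⊆ U, m ≤ ∑ x ∈ U', (w x : ℝ) ∧ ∑ x ∈ U', (w x : ℝ) ≤ 2 * m := by
  classical
  induction U using Finset.induction_on with
  | empty =>
    exact ⟨∅, subset_rfl, hU, by simpa using hm0⟩
  | insert x U hx ih =>
    by_cases h : m ≤ ∑ x ∈ U, (w x : ℝ)
    · obtain ⟨U', h1, h2⟩ := ih h
      exact ⟨U', h1.trans (Finset.subset_insert _ _), h2⟩
    · refine ⟨insert x U, subset_rfl, hU, ?_⟩
      rw [Finset.sum_insert hx]
      push Not at h
      linarith [hm x]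

/-- If a graph is cut into small pieces by a labelling of its vertices, then a `1`-Lipschitz
function which vanishes near the cuts and is at least `b` on half of the vertices bounds the
Cheeger constant. -/
theorem lpCheeger_le_of_label [Fintype V] [Nonempty V] {Γ : SimpleGraph V} {p : ℝ} (hp : 1 ≤ p)
    {X : Type*} (label : V → X) (φ : V → ℝ) {b : ℝ} (hb : 0 < b) (hφ : ∀ v, 0 ≤ φ v)
    (hlip : ∀ v w, Γ.Adj v w → |φ v - φ w| ≤ 1)
    (hcut : ∀ v w, Γ.Adj v w → label v = label w ∨ (φ v ≤ 1 ∧ φ w ≤ 1))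
    (hsmall : ∀ v, 8 * ({w | label w = label v} : Set V).ncard ≤ Fintype.card V)
    (hlarge : Fintype.card V ≤ 2 * ({v | b ≤ φ v} : Set V).ncard) :
    lpCheeger Γ p ≤ 32 / b := by
  classical
  set S : Finset V := Finset.univ.filter fun v => b ≤ φ v with hSdef
  have hS : Fintype.card V ≤ 2 * S.card := by
    rw [show ({v | b ≤ φ v} : Set V) = (S : Set V) by ext; simp [hSdef],
      Set.ncard_coe_finset] at hlarge
    exact hlarge
  have hSR : (Fintype.card V : ℝ) ≤ 2 * S.card := by exact_mod_cast hS
  have hsum : ∀ U : Finset X, (∑ x ∈ U, ((S.filter fun v => label v = x).card : ℝ)) =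
      ((S.filter fun v => label v ∈ U).card : ℝ) := by
    intro U
    rw [← Nat.cast_sum, Nat.cast_inj]
    rw [Finset.card_eq_sum_card_fiberwise (f := label) (t := U)]
    · refine Finset.sum_congr rfl fun x hx => ?_
      congr 1
      ext v
      simp only [Finset.mem_filter]
      constructor
      · rintro ⟨h1, rfl⟩
        exact ⟨⟨h1, hx⟩, rfl⟩
      · rintro ⟨⟨h1, -⟩, h2⟩
        exact ⟨h1, h2⟩
    · intro v hv
      simp only [Finset.coe_filter, Set.mem_ofPred_eq] at hv
      exact hv.2
  -- The labels in `U` carry between `1/8` and `1/4` of all vertices inside `S`. As `S` has at least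
  -- half of the vertices, at least `1/4` remain in `S` outside `U`.
  obtain ⟨U, -, hU1, hU2⟩ := exists_subset_sum_between
    (fun x => (S.filter fun v => label v = x).card) (m := (Fintype.card V : ℝ) / 8)
    (by positivity)
    (by
      intro x
      by_cases hx : ∃ v, label v = x
      · obtain ⟨v, rfl⟩ := hx
        have h1 : (S.filter fun w => label w = label v).card ≤
            ({w | label w = label v} : Set V).ncard := by
          rw [← Set.ncard_coe_finset]
          exact Set.ncard_le_ncard (fun w hw => by simp at hw; exact hw.2) (Set.toFinite _)
        have h2 : 8 * (S.filter fun w => label w = label v).card ≤ Fintype.card V :=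
          (Nat.mul_le_mul_left 8 h1).trans (hsmall v)
        have h3 : (8 : ℝ) * (S.filter fun w => label w = label v).card ≤ Fintype.card V := by
          exact_mod_cast h2
        linarith
      · push Not at hx
        simp [hx]
        positivity)
    (S.image label)
    (by
      rw [hsum, Finset.filter_true_of_mem fun v hv => Finset.mem_image_of_mem _ hv]
      have : (0 : ℝ) ≤ Fintype.card V := Nat.cast_nonneg _
      linarith)
  rw [hsum] at hU1 hU2
  have hsplit : ((S.filter fun v => label v ∈ U).card : ℝ) +
      (S.filter fun v => ¬ label v ∈ U).card = S.card := by
    exact_mod_cast Finset.card_filter_add_card_filter_not (s := S) (fun v => label v ∈ U)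
  refine (lpCheeger_le_of_separated hp (f := fun v => if label v ∈ U then φ v else 0)
    (S := S.filter fun v => label v ∈ U) (T := S.filter fun v => ¬ label v ∈ U) (θ := 1 / 8)
    (by norm_num) hb ?_ ?_ ?_ ?_ ?_).trans (le_of_eq (by field_simp; norm_num))
  · intro v w hvw
    rcases hcut v w hvw with h | ⟨h1, h2⟩
    · rw [h]
      split_ifs
      · exact hlip v w hvw
      · norm_num
    · have h3 := hφ v
      have h4 := hφ w
      split_ifs <;> rw [abs_le] <;> constructor <;> linarith
  · linarith
  · linarith
  · intro v hv
    simp only [hSdef, Finset.mem_filter] at hv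
    simpa [hv.2] using hv.1.2
  · intro v hv
    simp only [hSdef, Finset.mem_filter] at hv
    simp [hv.2]

end Cheeger

/-! ## Lamps and cursors -/

namespace LampGroup

variable {Γ : Type*} [Group Γ]

/-- The position of the cursor, as a homomorphism. -/
def cursorHom (Γ : Type*) [Group Γ] : LampGroup Γ →* Multiplicative ℤ where
  toFun z := Multiplicative.ofAdd z.cursor
  map_one' := rfl
  map_mul' _ _ := rfl

theorem shift_zpow_cursor (j : ℤ) : ((shift : LampGroup Γ) ^ j).cursor = j := by
  induction j using Int.induction_on with
  | zero => simp
  | succ i ih => rw [zpow_add_one, mul_cursor, ih]; rfl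
  | pred i ih => rw [zpow_sub_one, mul_cursor, ih]; rfl

theorem shift_zpow_lamp (j x : ℤ) : ((shift : LampGroup Γ) ^ j).lamp x = 1 := by
  induction j using Int.induction_on generalizing x with
  | zero => simp
  | succ i ih => rw [zpow_add_one, mul_lamp, ih]; simp [shift]
  | pred i ih => rw [zpow_sub_one, mul_lamp, ih]; simp [shift]

theorem conj_dirac_cursor (i j : ℤ) (g : Γ) :
    (shift ^ j * dirac i g * shift ^ (-j)).cursor = 0 := by
  simp [shift_zpow_cursor, dirac]

theorem conj_dirac_lamp (i j : ℤ) (g : Γ) (x : ℤ) :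
    (shift ^ j * dirac i g * shift ^ (-j)).lamp x = if x = j + i then g else 1 := by
  simp only [mul_lamp, shift_zpow_lamp, shift_zpow_cursor, one_mul, mul_one, dirac,
    MonoidHom.coe_mk, OneHom.coe_mk, Pi.mulSingle_apply]
  congr 1
  simp only [eq_iff_iff]
  omega

end LampGroup

namespace LampData

variable {A B : Type*} [Group A] [Group B] {Γ : ℕ → Type*} [∀ s, Group (Γ s)]

theorem proj_ofA (D : LampData A B Γ) (s : ℕ) (a : A) :
    D.proj s (ofA a) = LampGroup.dirac (-(D.k s : ℤ)) (D.a s a) := by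
  simp [proj, ofA]

theorem proj_ofB (D : LampData A B Γ) (s : ℕ) (b : B) :
    D.proj s (ofB b) = LampGroup.dirac (D.k s : ℤ) (D.b s b) := by
  simp [proj, ofB]

theorem proj_tau (D : LampData A B Γ) (s : ℕ) : D.proj s tau = LampGroup.shift := by
  simp [proj, tau]

theorem proj_conj_ofA (D : LampData A B Γ) (s : ℕ) (j : ℤ) (a : A) :
    (D.proj s (tau ^ j * ofA a * tau ^ (-j))).cursor = 0 ∧ ∀ x,
      (D.proj s (tau ^ j * ofA a * tau ^ (-j))).lamp x =
        if x = j - D.k s then D.a s a else 1 := by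
  rw [map_mul, map_mul, map_zpow, map_zpow, proj_tau, proj_ofA]
  exact ⟨LampGroup.conj_dirac_cursor _ _ _, LampGroup.conj_dirac_lamp _ _ _⟩

theorem proj_conj_ofB (D : LampData A B Γ) (s : ℕ) (j : ℤ) (b : B) :
    (D.proj s (tau ^ j * ofB b * tau ^ (-j))).cursor = 0 ∧ ∀ x,
      (D.proj s (tau ^ j * ofB b * tau ^ (-j))).lamp x =
        if x = j + D.k s then D.b s b else 1 := by
  rw [map_mul, map_mul, map_zpow, map_zpow, proj_tau, proj_ofB]
  exact ⟨LampGroup.conj_dirac_cursor _ _ _, LampGroup.conj_dirac_lamp _ _ _⟩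

/-! ## Elements moving the cursor inside a block -/

/-- The subgroup of the free product consisting of the words which switch lamps at cursor positions
in `I` only, and come back to the origin. -/
def blockSubgroup (A B : Type*) [Group A] [Group B] (I : Set ℤ) : Subgroup (FreeProd A B) :=
  Subgroup.closure {g | ∃ j ∈ I, ∃ x ∈ Set.range ofA ∪ Set.range ofB,
    g = tau ^ j * x * tau ^ (-j)}

theorem blockSubgroup_induction {I : Set ℤ} {P : FreeProd A B → Prop}
    (hA : ∀ j ∈ I, ∀ a : A, P (tau ^ j * ofA a * tau ^ (-j)))
    (hB : ∀ j ∈ I, ∀ b : B, P (tau ^ j * ofB b * tau ^ (-j)))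
    (one : P 1) (mul : ∀ g h, g ∈ blockSubgroup A B I → h ∈ blockSubgroup A B I →
      P g → P h → P (g * h))
    (inv : ∀ g, g ∈ blockSubgroup A B I → P g → P g⁻¹)
    {g : FreeProd A B} (hg : g ∈ blockSubgroup A B I) : P g := by
  refine Subgroup.closure_induction (p := fun g _ => P g) ?_ one
    (fun g h hg hh => mul g h hg hh) (fun g hg => inv g hg) hg
  rintro g ⟨j, hj, x, ⟨a, rfl⟩ | ⟨b, rfl⟩, rfl⟩
  · exact hA j hj a
  · exact hB j hj b

theorem proj_cursor_eq_zero (D : LampData A B Γ) (s : ℕ) {I : Set ℤ} {g : FreeProd A B}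
    (hg : g ∈ blockSubgroup A B I) : (D.proj s g).cursor = 0 := by
  refine blockSubgroup_induction (P := fun g => (D.proj s g).cursor = 0)
    (fun j _ a => (D.proj_conj_ofA s j a).1) (fun j _ b => (D.proj_conj_ofB s j b).1)
    (by simp) (fun g h _ _ h1 h2 => by simp [h1, h2]) (fun g _ h1 => by simp [h1]) hg

theorem proj_lamp_mul (D : LampData A B Γ) (s : ℕ) {I : Set ℤ} {g : FreeProd A B}
    (hg : g ∈ blockSubgroup A B I) (h : FreeProd A B) (x : ℤ) :
    (D.proj s (g * h)).lamp x = (D.proj s g).lamp x * (D.proj s h).lamp x := by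
  rw [map_mul, LampGroup.mul_lamp, D.proj_cursor_eq_zero s hg, sub_zero]

theorem proj_lamp_inv (D : LampData A B Γ) (s : ℕ) {I : Set ℤ} {g : FreeProd A B}
    (hg : g ∈ blockSubgroup A B I) (x : ℤ) :
    (D.proj s g⁻¹).lamp x = ((D.proj s g).lamp x)⁻¹ := by
  rw [map_inv, LampGroup.inv_lamp, D.proj_cursor_eq_zero s hg, add_zero]

theorem proj_lamp_eq_one (D : LampData A B Γ) (s : ℕ) {I : Set ℤ} {g : FreeProd A B}
    (hg : g ∈ blockSubgroup A B I) {x : ℤ} (h1 : x + D.k s ∉ I) (h2 : x - D.k s ∉ I) :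
    (D.proj s g).lamp x = 1 := by
  refine blockSubgroup_induction (P := fun g => (D.proj s g).lamp x = 1) ?_ ?_ (by simp)
    (fun g h hg _ e1 e2 => by rw [D.proj_lamp_mul s hg, e1, e2, one_mul])
    (fun g hg e1 => by rw [D.proj_lamp_inv s hg, e1, inv_one]) hg
  · intro j hj a
    rw [(D.proj_conj_ofA s j a).2, if_neg]
    rintro rfl
    exact h1 (by simpa using hj)
  · intro j hj b
    rw [(D.proj_conj_ofB s j b).2, if_neg]
    rintro rfl
    exact h2 (by simpa using hj)

/-- Letters of `B` reach the lamp `x` at level `s` only from cursor position `x - k s`, which is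
excluded, and letters of `A` only from `x + k s`. Since `k 0 = 0`, the level `0` lamp at `x + k s`
records the same letters of `A` in the same order, mixed with letters of `B` that `q` kills. -/
theorem proj_lamp_eq_a (D : LampData A B Γ) {q : Γ 0 →* A} (hqa : ∀ a, q (D.a 0 a) = a)
    (hqb : ∀ b, q (D.b 0 b) = 1) (s : ℕ) {I : Set ℤ} {g : FreeProd A B}
    (hg : g ∈ blockSubgroup A B I) {x : ℤ} (hx : x - D.k s ∉ I) :
    (D.proj s g).lamp x = D.a s (q ((D.proj 0 g).lamp (x + D.k s))) := by
  refine blockSubgroup_induction (P := fun g => (D.proj s g).lamp x =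
    D.a s (q ((D.proj 0 g).lamp (x + D.k s)))) ?_ ?_ (by simp)
    (fun g h hg _ e1 e2 => by
      rw [D.proj_lamp_mul s hg, D.proj_lamp_mul 0 hg, e1, e2, map_mul, map_mul])
    (fun g hg e1 => by
      rw [D.proj_lamp_inv s hg, D.proj_lamp_inv 0 hg, e1, map_inv, map_inv]) hg
  · intro j hj a
    rw [(D.proj_conj_ofA s j a).2, (D.proj_conj_ofA 0 j a).2, D.k_zero]
    by_cases h : x = j - D.k s
    · rw [if_pos h, if_pos (by rw [h]; simp), hqa]
    · rw [if_neg h, if_neg (fun h' => h (by push_cast at h'; omega)), map_one, map_one]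
  · intro j hj b
    rw [(D.proj_conj_ofB s j b).2, (D.proj_conj_ofB 0 j b).2, if_neg]
    · split_ifs
      · rw [hqb, map_one]
      · rw [map_one, map_one]
    · rintro rfl
      exact hx (by simpa using hj)

theorem proj_lamp_eq_b (D : LampData A B Γ) {q : Γ 0 →* B} (hqa : ∀ a, q (D.a 0 a) = 1)
    (hqb : ∀ b, q (D.b 0 b) = b) (s : ℕ) {I : Set ℤ} {g : FreeProd A B}
    (hg : g ∈ blockSubgroup A B I) {x : ℤ} (hx : x + D.k s ∉ I) :
    (D.proj s g).lamp x = D.b s (q ((D.proj 0 g).lamp (x - D.k s))) := by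
  refine blockSubgroup_induction (P := fun g => (D.proj s g).lamp x =
    D.b s (q ((D.proj 0 g).lamp (x - D.k s)))) ?_ ?_ (by simp)
    (fun g h hg _ e1 e2 => by
      rw [D.proj_lamp_mul s hg, D.proj_lamp_mul 0 hg, e1, e2, map_mul, map_mul])
    (fun g hg e1 => by
      rw [D.proj_lamp_inv s hg, D.proj_lamp_inv 0 hg, e1, map_inv, map_inv]) hg
  · intro j hj a
    rw [(D.proj_conj_ofA s j a).2, (D.proj_conj_ofA 0 j a).2, if_neg]
    · split_ifs
      · rw [hqa, map_one]
      · rw [map_one, map_one]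
    · rintro rfl
      exact hx (by simpa using hj)
  · intro j hj b
    rw [(D.proj_conj_ofB s j b).2, (D.proj_conj_ofB 0 j b).2, D.k_zero]
    by_cases h : x = j + D.k s
    · rw [if_pos h, if_pos (by rw [h]; simp), hqb]
    · rw [if_neg h, if_neg (fun h' => h (by push_cast at h'; omega)), map_one, map_one]

open scoped commutatorElement in
-- The data give only some abstract isomorphism with `A_s × B_s`. Finiteness repairs this: the
-- natural map from `A × B` to the quotient is surjective because `A_s` and `B_s` generate, hence
-- bijective by counting, and its inverse respects the two factors.
theorem exists_retraction [Finite A] [Finite B] (D : LampData A B Γ) (s : ℕ) :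
    ∃ q : Γ s →* A × B, (∀ a, q (D.a s a) = (a, 1)) ∧ ∀ b, q (D.b s b) = (1, b) := by
  classical
  set N : Subgroup (Γ s) := Subgroup.normalClosure
    ((⁅(D.a s).range, (D.b s).range⁆ : Subgroup (Γ s)) : Set (Γ s)) with hN
  set m : Γ s →* Γ s ⧸ N := QuotientGroup.mk' N
  have hcomm : ∀ a b, Commute (m.comp (D.a s) a) (m.comp (D.b s) b) := by
    intro a b
    have h : ⁅D.a s a, D.b s b⁆ ∈ N := Subgroup.subset_normalClosure
      (Subgroup.commutator_mem_commutator ⟨a, rfl⟩ ⟨b, rfl⟩)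
    have h' : m ⁅D.a s a, D.b s b⁆ = 1 := (QuotientGroup.eq_one_iff _).2 h
    rw [map_commutatorElement] at h'
    exact commutatorElement_eq_one_iff_commute.1 h'
  set F : A × B →* Γ s ⧸ N := MonoidHom.noncommCoprod _ _ hcomm
  have hFa : ∀ a, F (a, 1) = m (D.a s a) := fun a => by simp [F]
  have hFb : ∀ b, F (1, b) = m (D.b s b) := fun b => by simp [F]
  have hsurj : Function.Surjective F := by
    rw [← MonoidHom.range_eq_top, eq_top_iff]
    rintro y -
    obtain ⟨x, rfl⟩ := QuotientGroup.mk'_surjective N y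
    have hle : (⊤ : Subgroup (Γ s)) ≤ F.range.comap m := by
      rw [← D.generates s, Subgroup.closure_le]
      rintro _ (⟨a, rfl⟩ | ⟨b, rfl⟩)
      · exact ⟨(a, 1), hFa a⟩
      · exact ⟨(1, b), hFb b⟩
    exact hle (Subgroup.mem_top x)
  have hcard : Nat.card (A × B) = Nat.card (Γ s ⧸ N) := by
    obtain ⟨e⟩ := D.quotient_iso s
    rw [Nat.card_congr e.toEquiv, Nat.card_prod, Nat.card_prod,
      Nat.card_congr ((D.a s).ofInjective (D.a_injective s)).toEquiv,
      Nat.card_congr ((D.b s).ofInjective (D.b_injective s)).toEquiv]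
  have hbij : Function.Bijective F :=
    (Nat.bijective_iff_surjective_and_card F).2 ⟨hsurj, hcard⟩
  refine ⟨((MulEquiv.ofBijective F hbij).symm : Γ s ⧸ N →* A × B).comp m, fun a => ?_, fun b => ?_⟩
  · simp only [MonoidHom.comp_apply, ← hFa]
    exact (MulEquiv.ofBijective F hbij).symm_apply_apply _
  · simp only [MonoidHom.comp_apply, ← hFb]
    exact (MulEquiv.ofBijective F hbij).symm_apply_apply _

/-- In a short block the first levels determine all the others. -/
theorem mem_iInf_ker_of_forall_le [Finite A] [Finite B] (D : LampData A B Γ) {s L : ℕ}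
    (hL : L ≤ D.k (s + 1)) {i : ℤ} {g : FreeProd A B}
    (hg : g ∈ blockSubgroup A B (Set.Ico i (i + 2 * L)))
    (h : ∀ t ≤ s, ∀ x, (D.proj t g).lamp x = 1) : g ∈ ⨅ t, (D.proj t).ker := by
  obtain ⟨q, hqa, hqb⟩ := D.exists_retraction 0
  rw [Subgroup.mem_iInf]
  intro t
  rw [MonoidHom.mem_ker]
  ext x
  swap
  · simpa using D.proj_cursor_eq_zero t hg
  rw [LampGroup.one_lamp]
  rcases le_or_gt t s with hts | hts
  · exact h t hts x
  have hk : L ≤ D.k t := hL.trans (D.k_monotone hts)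
  -- The positions `x - k t` and `x + k t` are `2 * k t ≥ 2 * L` apart, so at most one lies in the
  -- half-open block.
  by_cases hx : x - D.k t ∈ Set.Ico i (i + 2 * L)
  · have hx' : x + D.k t ∉ Set.Ico i (i + 2 * L) := by
      simp only [Set.mem_Ico] at hx ⊢
      omega
    rw [D.proj_lamp_eq_b (q := (MonoidHom.snd A B).comp q) (by simp [hqa]) (by simp [hqb]) t hg hx',
      h 0 (Nat.zero_le _), map_one, map_one]
  · rw [D.proj_lamp_eq_a (q := (MonoidHom.fst A B).comp q) (by simp [hqa]) (by simp [hqb]) t hg hx,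
      h 0 (Nat.zero_le _), map_one, map_one]

theorem card_blockSubgroup_le [Finite A] [Finite B] [∀ s, Finite (Γ s)] (D : LampData A B Γ)
    {s L : ℕ} (hL : L ≤ D.k (s + 1)) (i : ℤ) :
    Finite ((blockSubgroup A B (Set.Ico i (i + 2 * L))).map D.toDelta) ∧
    Nat.card ((blockSubgroup A B (Set.Ico i (i + 2 * L))).map D.toDelta) ≤
      ∏ t ∈ Finset.range (s + 1), Nat.card (Γ t) ^ (2 * L + 2 * D.k t) := by
  set H := blockSubgroup A B (Set.Ico i (i + 2 * L))
  have hrep : ∀ h : H.map D.toDelta, ∃ g ∈ H, D.toDelta g = h := fun h => h.2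
  choose g hgH hg using hrep
  -- From the block, level `t` lamps can be switched only in `[i - k t, i + 2L + k t)`; these values
  -- for `t ≤ s` determine the element.
  let Φ : H.map D.toDelta → ∀ t : Fin (s + 1), Fin (2 * L + 2 * D.k t) → Γ t :=
    fun h t n => (D.proj t (g h)).lamp (i - D.k t + (n : ℕ))
  have hΦ : Function.Injective Φ := by
    intro h h' e
    apply Subtype.ext
    rw [← hg, ← hg]
    refine QuotientGroup.eq.2 (D.mem_iInf_ker_of_forall_le hL
      (H.mul_mem (H.inv_mem (hgH h)) (hgH h')) ?_)
    intro t ht x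
    rw [D.proj_lamp_mul t (H.inv_mem (hgH h)), D.proj_lamp_inv t (hgH h), inv_mul_eq_one]
    by_cases hx : x ∈ Set.Ico (i - D.k t) (i - D.k t + (2 * L + 2 * D.k t : ℕ))
    · have hx1 := hx.1
      have hx2 := hx.2
      have := congrFun (congrFun e ⟨t, Nat.lt_succ_of_le ht⟩)
        ⟨(x - (i - D.k t)).toNat, by dsimp only; omega⟩
      simp only [Φ] at this
      rwa [show i - D.k t + ((x - (i - D.k t)).toNat : ℤ) = x by omega] at this
    · have h1 : x + D.k t ∉ Set.Ico i (i + 2 * L) := by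
        simp only [Set.mem_Ico] at hx ⊢
        push_cast at hx
        omega
      have h2 : x - D.k t ∉ Set.Ico i (i + 2 * L) := by
        simp only [Set.mem_Ico] at hx ⊢
        push_cast at hx
        omega
      rw [D.proj_lamp_eq_one t (hgH h) h1 h2, D.proj_lamp_eq_one t (hgH h') h1 h2]
  refine ⟨Finite.of_injective Φ hΦ, (Nat.card_le_card_of_injective Φ hΦ).trans (le_of_eq ?_)⟩
  rw [Nat.card_pi, Finset.prod_range]
  refine Finset.prod_congr rfl fun t _ => ?_
  rw [Nat.card_fun, Nat.card_fin]

/-! ## The size of the lamp groups -/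

open scoped Pointwise in
-- A walk of length `n` multiplies `n` generators, so a finite diameter `l` makes the whole group
-- the `l`-th power of the finite set `A_s ∪ B_s`.
theorem finite_and_card_le [Finite A] [Finite B] (D : LampData A B Γ) {s : ℕ}
    (h : (D.lampCayley s).ediam ≠ ⊤) :
    Finite (Γ s) ∧ Nat.card (Γ s) ≤ (Nat.card A + Nat.card B) ^ D.l s := by
  classical
  have hfin : (Set.range (D.a s) ∪ Set.range (D.b s)).Finite := Set.toFinite _
  set S : Finset (Γ s) := hfin.toFinset with hS
  have hmem : ∀ g, g ∈ S ↔ g ∈ Set.range (D.a s) ∪ Set.range (D.b s) :=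
    fun g => hfin.mem_toFinset
  have h1S : (1 : Γ s) ∈ S := (hmem 1).2 (Or.inl ⟨1, map_one _⟩)
  have hinv : ∀ g ∈ S, g⁻¹ ∈ S := by
    intro g hg
    rw [hmem] at hg ⊢
    rcases hg with ⟨a, rfl⟩ | ⟨b, rfl⟩
    · exact Or.inl ⟨a⁻¹, map_inv _ _⟩
    · exact Or.inr ⟨b⁻¹, map_inv _ _⟩
  have hwalk : ∀ u v : Γ s, ∀ w : (D.lampCayley s).Walk u v, u⁻¹ * v ∈ S ^ w.length := by
    intro u v w
    induction w with
    | nil => simp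
    | @cons u v' v hadj w ih =>
      rw [SimpleGraph.Walk.length_cons, pow_succ']
      have : u⁻¹ * v' ∈ S := by
        rcases ((SimpleGraph.mulCayley_adj _ _ _).1 hadj).2 with h | h
        · exact (hmem _).2 h
        · have := hinv _ ((hmem _).2 h)
          simpa using this
      have h2 := Finset.mul_mem_mul this ih
      simpa [mul_assoc] using h2
  have huniv : ∀ v : Γ s, v ∈ S ^ D.l s := by
    intro v
    obtain ⟨w, hw⟩ :=
      ((SimpleGraph.connected_of_ediam_ne_top h).preconnected 1 v).exists_walk_length_eq_dist
    have h1 := hwalk 1 v w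
    rw [inv_one, one_mul, hw] at h1
    exact Finset.pow_subset_pow_right h1S (SimpleGraph.dist_le_diam h) h1
  have hset : (Set.univ : Set (Γ s)) ⊆ (S ^ D.l s : Finset (Γ s)) := fun v _ => huniv v
  have hcS : S.card ≤ Nat.card A + Nat.card B := by
    rw [← Set.ncard_eq_toFinset_card _ hfin]
    refine (Set.ncard_union_le _ _).trans (add_le_add ?_ ?_)
    · rw [← Set.image_univ, ← Set.ncard_univ]
      exact Set.ncard_image_le
    · rw [← Set.image_univ, ← Set.ncard_univ]
      exact Set.ncard_image_le
  refine ⟨Set.finite_univ_iff.1 ((Finset.finite_toSet _).subset hset), ?_⟩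
  calc Nat.card (Γ s) = (Set.univ : Set (Γ s)).ncard := (Set.ncard_univ _).symm
    _ ≤ (S ^ D.l s).card := by
        rw [← Set.ncard_coe_finset]
        exact Set.ncard_le_ncard hset
    _ ≤ S.card ^ D.l s := Finset.card_pow_le
    _ ≤ _ := Nat.pow_le_pow_left hcS _

theorem toDelta_ofA_injective (D : LampData A B Γ) :
    Function.Injective fun a => D.toDelta (ofA a) := by
  intro a a' h
  have h1 : (ofA a)⁻¹ * ofA a' ∈ ⨅ s, (D.proj s).ker := QuotientGroup.eq.1 h
  have h2 : D.proj 0 ((ofA a)⁻¹ * ofA a') = 1 := (Subgroup.mem_iInf.1 h1) 0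
  rw [map_mul, map_inv, inv_mul_eq_one, proj_ofA, proj_ofA] at h2
  have h3 := congrArg (fun z => z.lamp (-(D.k 0 : ℤ))) h2
  simp only [LampGroup.dirac, MonoidHom.coe_mk, OneHom.coe_mk, Pi.mulSingle_eq_same] at h3
  exact D.a_injective 0 h3

theorem toDelta_ofB_injective (D : LampData A B Γ) :
    Function.Injective fun b => D.toDelta (ofB b) := by
  intro a a' h
  have h1 : (ofB a)⁻¹ * ofB a' ∈ ⨅ s, (D.proj s).ker := QuotientGroup.eq.1 h
  have h2 : D.proj 0 ((ofB a)⁻¹ * ofB a') = 1 := (Subgroup.mem_iInf.1 h1) 0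
  rw [map_mul, map_inv, inv_mul_eq_one, proj_ofB, proj_ofB] at h2
  have h3 := congrArg (fun z => z.lamp (D.k 0 : ℤ)) h2
  simp only [LampGroup.dirac, MonoidHom.coe_mk, OneHom.coe_mk, Pi.mulSingle_eq_same] at h3
  exact D.b_injective 0 h3

theorem finite_genSet [Finite A] [Finite B] (D : LampData A B Γ) : D.genSet.Finite :=
  (((Set.finite_range _).union (Set.finite_range _)).union (Set.toFinite _)).image _

theorem finite_neighborSet [Finite A] [Finite B] (D : LampData A B Γ) :
    (D.cayleyGraph.neighborSet 1).Finite := by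
  refine (D.finite_genSet.union D.finite_genSet.inv).subset fun v hv => ?_
  have := ((SimpleGraph.mulCayley_adj _ _ _).1 hv).2
  simpa using this

theorem ncard_le_degree_add_one [Finite A] [Finite B] (D : LampData A B Γ) {X : Type*}
    {f : X → D.Delta} (hf : Function.Injective f) (hfg : ∀ x, f x ∈ D.genSet) :
    Nat.card X ≤ D.degree + 1 := by
  rw [← Set.ncard_univ, ← Set.ncard_image_of_injective _ hf]
  refine (Set.ncard_le_ncard (t := insert 1 (D.cayleyGraph.neighborSet 1)) ?_
    (D.finite_neighborSet.insert _)).trans (Set.ncard_insert_le _ _)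
  rintro _ ⟨x, -, rfl⟩
  by_cases h : f x = 1
  · exact Or.inl h
  · exact Or.inr ((SimpleGraph.mulCayley_adj _ _ _).2 ⟨Ne.symm h, Or.inl (by simpa using hfg x)⟩)

/-- Level `0` shows that `A` and `B` embed in `Δ`, and their nontrivial elements are neighbours of
the identity. This is how the constants come to depend on the degree alone. -/
theorem card_add_card_le [Finite A] [Finite B] (D : LampData A B Γ) :
    Nat.card A + Nat.card B ≤ 2 * D.degree + 2 := by
  have h1 := D.ncard_le_degree_add_one D.toDelta_ofA_injective
    fun a => ⟨_, Or.inl (Or.inl ⟨a, rfl⟩), rfl⟩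
  have h2 := D.ncard_le_degree_add_one D.toDelta_ofB_injective
    fun b => ⟨_, Or.inl (Or.inr ⟨b, rfl⟩), rfl⟩
  omega

/-! ## Cursor and lamps of an element of the diagonal product -/

/-- The homomorphism from the free product to `ℤ` recording the position of the cursor. -/
def freeCursor (A B : Type*) [Group A] [Group B] : FreeProd A B →* Multiplicative ℤ :=
  Monoid.Coprod.lift 1 (MonoidHom.id _)

/-- The cursor is the same at every level, so it descends to `Δ`. -/
theorem cursorHom_comp_proj (D : LampData A B Γ) (s : ℕ) :
    (LampGroup.cursorHom (Γ s)).comp (D.proj s) = freeCursor A B := by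
  refine Monoid.Coprod.hom_ext (Monoid.Coprod.hom_ext ?_ ?_) ?_
  · ext a
    rfl
  · ext b
    rfl
  · ext
    simp [freeCursor, proj, LampGroup.cursorHom, LampGroup.shift]

/-- The position of the cursor, as a homomorphism on the diagonal product. -/
def deltaCursor (D : LampData A B Γ) : D.Delta →* Multiplicative ℤ :=
  QuotientGroup.lift _ (freeCursor A B) fun g hg => by
    rw [← D.cursorHom_comp_proj 0, MonoidHom.mem_ker, MonoidHom.comp_apply,
      MonoidHom.mem_ker.1 ((Subgroup.mem_iInf.1 hg) 0), map_one]

/-- The position of the cursor of an element of the diagonal product. -/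
def pos (D : LampData A B Γ) (g : D.Delta) : ℤ := Multiplicative.toAdd (D.deltaCursor g)

theorem pos_mul (D : LampData A B Γ) (g h : D.Delta) : D.pos (g * h) = D.pos g + D.pos h := by
  simp [pos]

theorem pos_inv (D : LampData A B Γ) (g : D.Delta) : D.pos g⁻¹ = -D.pos g := by
  simp [pos]

theorem pos_ofA (D : LampData A B Γ) (a : A) : D.pos (D.toDelta (ofA a)) = 0 := rfl

theorem pos_ofB (D : LampData A B Γ) (b : B) : D.pos (D.toDelta (ofB b)) = 0 := rfl

theorem pos_tau (D : LampData A B Γ) : D.pos (D.toDelta tau) = 1 := rfl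

/-- The lamp part of an element of the diagonal product. -/
def lampPart (D : LampData A B Γ) (g : D.Delta) : D.Delta := g * D.toDelta tau ^ (-D.pos g)

theorem lampPart_mul (D : LampData A B Γ) (g : D.Delta) :
    D.lampPart g * D.toDelta tau ^ D.pos g = g := by
  simp [lampPart]

theorem lampPart_mul_tau (D : LampData A B Γ) (g : D.Delta) :
    D.lampPart (g * D.toDelta tau) = D.lampPart g := by
  rw [lampPart, lampPart, pos_mul, pos_tau, mul_assoc, ← zpow_one_add]
  congr 2
  ring

/-- The image in `Δ` of the words which switch lamps at cursor positions in `I` only. -/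
def deltaBlock (D : LampData A B Γ) (I : Set ℤ) : Subgroup D.Delta :=
  (blockSubgroup A B I).map D.toDelta

theorem conj_mem_deltaBlock (D : LampData A B Γ) {I : Set ℤ} {j : ℤ} (hj : j ∈ I)
    {x : FreeProd A B} (hx : x ∈ Set.range ofA ∪ Set.range ofB) :
    D.toDelta tau ^ j * D.toDelta x * D.toDelta tau ^ (-j) ∈ D.deltaBlock I := by
  refine ⟨tau ^ j * x * tau ^ (-j), Subgroup.subset_closure ⟨j, hj, x, hx, rfl⟩, ?_⟩
  rw [map_mul, map_mul, map_zpow, map_zpow]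

/-- A generator from `A` or `B` multiplies the lamp part on the right by its conjugate by `τ ^ pos
g`, whereas `τ` and its inverse move only the cursor. -/
theorem step_of_mul_mem_genSet (D : LampData A B Γ) {g h : D.Delta} (hs : g⁻¹ * h ∈ D.genSet) :
    (D.pos h = D.pos g ∧
      ∀ I : Set ℤ, D.pos g ∈ I → (D.lampPart g)⁻¹ * D.lampPart h ∈ D.deltaBlock I) ∨
    ((D.pos h = D.pos g + 1 ∨ D.pos g = D.pos h + 1) ∧ D.lampPart h = D.lampPart g) := by
  obtain ⟨x, hx, hxe⟩ := hs
  obtain rfl : h = g * D.toDelta x := by rw [hxe]; simp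
  rcases hx with hx | rfl | rfl
  · left
    have hp : D.pos (D.toDelta x) = 0 := by
      rcases hx with ⟨a, rfl⟩ | ⟨b, rfl⟩
      · exact D.pos_ofA a
      · exact D.pos_ofB b
    have hpos : D.pos (g * D.toDelta x) = D.pos g := by rw [pos_mul, hp, add_zero]
    refine ⟨hpos, fun I hI => ?_⟩
    have := D.conj_mem_deltaBlock hI hx
    convert this using 1
    rw [lampPart, lampPart, hpos]
    simp [mul_assoc]
  · right
    refine ⟨Or.inl ?_, D.lampPart_mul_tau g⟩
    rw [pos_mul, pos_tau]
  · right
    refine ⟨Or.inr ?_, ?_⟩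
    · rw [pos_mul, map_inv, pos_inv, pos_tau]
      ring
    · have := D.lampPart_mul_tau (g * D.toDelta tau⁻¹)
      rw [← this]
      congr 1
      simp

theorem step_of_adj (D : LampData A B Γ) {g h : D.Delta} (hgh : D.cayleyGraph.Adj g h) :
    (D.pos h = D.pos g ∧
      ∀ I : Set ℤ, D.pos g ∈ I → (D.lampPart g)⁻¹ * D.lampPart h ∈ D.deltaBlock I) ∨
    ((D.pos h = D.pos g + 1 ∨ D.pos g = D.pos h + 1) ∧ D.lampPart h = D.lampPart g) := by
  rcases ((SimpleGraph.mulCayley_adj _ _ _).1 hgh).2 with h1 | h1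
  · exact D.step_of_mul_mem_genSet h1
  · rcases D.step_of_mul_mem_genSet h1 with ⟨h2, h3⟩ | ⟨h2, h3⟩
    · refine Or.inl ⟨h2.symm, fun I hI => ?_⟩
      have := (D.deltaBlock I).inv_mem (h3 I (h2 ▸ hI))
      simpa using this
    · exact Or.inr ⟨h2.symm, h3.symm⟩

/-! ## Cutting the diagonal product into pieces -/

/-- The distance to the closest multiple of `2 * L`. -/
def tent (L : ℕ) (c : ℤ) : ℤ := min (c % (2 * L)) (2 * L - c % (2 * L))

theorem tent_nonneg {L : ℕ} (hL : 0 < L) (c : ℤ) : 0 ≤ tent L c := by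
  have h1 := Int.emod_nonneg c (b := 2 * (L : ℤ)) (by omega)
  have h2 := Int.emod_lt_of_pos c (b := 2 * (L : ℤ)) (by omega)
  exact le_min h1 (by omega)

theorem div_mod_succ {m : ℤ} (hm : 0 < m) (c : ℤ) :
    ((c + 1) / m = c / m ∧ (c + 1) % m = c % m + 1) ∨ (c % m = m - 1 ∧ (c + 1) % m = 0) := by
  have h0 := Int.mul_ediv_add_emod c m
  have h1 := Int.emod_nonneg c hm.ne'
  have h2 := Int.emod_lt_of_pos c hm
  rcases lt_or_ge (c % m + 1) m with h | h
  · left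
    exact (Int.ediv_emod_unique hm).2 ⟨by linarith, by omega, h⟩
  · right
    have h3 : c % m = m - 1 := by omega
    refine ⟨h3, ((Int.ediv_emod_unique (q := c / m + 1) hm).2 ⟨?_, le_rfl, hm⟩).2⟩
    rw [mul_add]
    linarith

theorem tent_succ {L : ℕ} (hL : 0 < L) (c : ℤ) :
    |tent L (c + 1) - tent L c| ≤ 1 ∧
      ((c + 1) / (2 * L) = c / (2 * L) ∨ (tent L (c + 1) ≤ 1 ∧ tent L c ≤ 1)) := by
  have h1 := Int.emod_nonneg c (b := 2 * (L : ℤ)) (by omega)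
  have h2 := Int.emod_lt_of_pos c (b := 2 * (L : ℤ)) (by omega)
  simp only [tent]
  rcases div_mod_succ (m := 2 * (L : ℤ)) (by omega) c with ⟨h3, h4⟩ | ⟨h3, h4⟩
  · refine ⟨?_, Or.inl h3⟩
    rw [h4, abs_le]
    omega
  · rw [h4, h3, abs_le]
    omega

theorem tent_add_tent {L : ℕ} (hL : 0 < L) (c : ℤ) : tent L c + tent L (c + L) = L := by
  have hm : (0 : ℤ) < 2 * L := by omega
  have h0 := Int.mul_ediv_add_emod c (2 * (L : ℤ))
  have h1 := Int.emod_nonneg c hm.ne'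
  have h2 := Int.emod_lt_of_pos c hm
  simp only [tent]
  rcases lt_or_ge (c % (2 * L)) L with h | h
  · have h3 : (c + L) % (2 * L) = c % (2 * L) + L :=
      ((Int.ediv_emod_unique (q := c / (2 * L)) hm).2
        ⟨by linarith, by omega, by omega⟩).2
    rw [h3]
    omega
  · have h3 : (c + L) % (2 * L) = c % (2 * L) - L :=
      ((Int.ediv_emod_unique (q := c / (2 * L) + 1) hm).2
        ⟨by rw [mul_add]; linarith, by omega, by omega⟩).2
    rw [h3]
    omega

/-- The block of length `2 * L` containing `c`, for the subdivision of `ℤ` shifted by `o`. -/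
def block (L : ℕ) (o q : ℤ) : Set ℤ := Set.Ico (2 * L * q - o) (2 * L * q - o + 2 * L)

theorem mem_block {L : ℕ} (hL : 0 < L) (o c : ℤ) : c ∈ block L o ((c + o) / (2 * L)) := by
  have hm : (0 : ℤ) < 2 * L := by omega
  have h0 := Int.mul_ediv_add_emod (c + o) (2 * (L : ℤ))
  have h1 := Int.emod_nonneg (c + o) hm.ne'
  have h2 := Int.emod_lt_of_pos (c + o) hm
  constructor <;> linarith

open scoped Pointwise in
/-- The piece of an element: the block of its cursor, and its lamp part up to what can be changed
without leaving the block. -/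
def label (D : LampData A B Γ) (L : ℕ) (o : ℤ) (g : D.Delta) : ℤ × Set D.Delta :=
  ((D.pos g + o) / (2 * L),
    D.lampPart g • (D.deltaBlock (block L o ((D.pos g + o) / (2 * L))) : Set D.Delta))

/-- Switching a lamp stays in the same coset of the block group, so the label changes only when the
cursor crosses between residues `2L - 1` and `0`, where the tent is `1` and `0`. -/
theorem label_eq_or (D : LampData A B Γ) {L : ℕ} (hL : 0 < L) (o : ℤ) {g h : D.Delta}
    (hgh : D.cayleyGraph.Adj g h) :
    |tent L (D.pos g + o) - tent L (D.pos h + o)| ≤ 1 ∧ (D.label L o g = D.label L o h ∨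
      (tent L (D.pos g + o) ≤ 1 ∧ tent L (D.pos h + o) ≤ 1)) := by
  rcases D.step_of_adj hgh with ⟨h1, h2⟩ | ⟨h1 | h1, h2⟩
  · rw [h1]
    refine ⟨by simp, Or.inl (Prod.ext (by simp [label, h1]) ?_)⟩
    simp only [label, h1]
    exact (leftCoset_eq_iff _).2 (h2 _ (mem_block hL o _))
  · have := tent_succ hL (D.pos g + o)
    rw [show D.pos g + o + 1 = D.pos h + o by omega] at this
    refine ⟨by rw [abs_sub_comm]; exact this.1, this.2.imp (fun h3 => ?_) And.symm⟩
    simp only [label, h2, h3]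
  · have := tent_succ hL (D.pos h + o)
    rw [show D.pos h + o + 1 = D.pos g + o by omega] at this
    refine ⟨this.1, this.2.imp (fun h3 => ?_) id⟩
    simp only [label, h2, h3]

theorem finite_and_ncard_label_le [Finite A] [Finite B] [∀ s, Finite (Γ s)] (D : LampData A B Γ)
    {s L : ℕ} (hL0 : 0 < L) (hL : L ≤ D.k (s + 1)) (o : ℤ) (g : D.Delta) :
    {h | D.label L o h = D.label L o g}.Finite ∧
    {h | D.label L o h = D.label L o g}.ncard ≤
      2 * L * ∏ t ∈ Finset.range (s + 1), Nat.card (Γ t) ^ (2 * L + 2 * D.k t) := by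
  set q := (D.pos g + o) / (2 * L) with hq
  obtain ⟨hfin, hcard⟩ := D.card_blockSubgroup_le hL (2 * L * q - o)
  set T : Set (ℤ × D.Delta) := block L o q ×ˢ (D.deltaBlock (block L o q) : Set D.Delta) with hT
  have hHfin : (D.deltaBlock (block L o q) : Set D.Delta).Finite := hfin
  have hTfin : T.Finite := (Set.finite_Ico _ _).prod hHfin
  have hTcard : T.ncard ≤
      2 * L * ∏ t ∈ Finset.range (s + 1), Nat.card (Γ t) ^ (2 * L + 2 * D.k t) := by
    rw [hT, Set.ncard_prod]
    refine Nat.mul_le_mul (le_of_eq ?_) hcard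
    rw [block, ← Finset.coe_Ico, Set.ncard_coe_finset, Int.card_Ico]
    omega
  -- Cursor and lamp part determine an element; inside a piece there are `2 * L` cursors and one
  -- coset of lamp parts.
  let F : D.Delta → ℤ × D.Delta := fun h => (D.pos h, (D.lampPart g)⁻¹ * D.lampPart h)
  have hF : Set.InjOn F {h | D.label L o h = D.label L o g} := by
    intro h _ h' _ e
    have e1 : D.pos h = D.pos h' := congrArg Prod.fst e
    have e2 : D.lampPart h = D.lampPart h' := mul_left_cancel (congrArg Prod.snd e)
    rw [← D.lampPart_mul h, ← D.lampPart_mul h', e1, e2]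
  have hmaps : Set.MapsTo F {h | D.label L o h = D.label L o g} T := by
    intro h hh
    have e1 : (D.pos h + o) / (2 * L) = q := congrArg Prod.fst hh
    have e2 := congrArg Prod.snd hh
    simp only [label, e1, ← hq] at e2
    refine ⟨?_, (leftCoset_eq_iff _).1 e2.symm⟩
    rw [← e1]
    exact mem_block hL0 o _
  exact ⟨Set.Finite.of_injOn hmaps hF hTfin,
    (Set.ncard_le_ncard_of_injOn F hmaps hF hTfin).trans hTcard⟩

/-- The Cheeger constant of a large finite subgraph of a diagonal product. -/
theorem lpCheeger_le_of_card [Finite A] [Finite B] [∀ s, Finite (Γ s)] (D : LampData A B Γ)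
    {s L : ℕ} (hL0 : 0 < L) (hL : L ≤ D.k (s + 1)) (G : D.cayleyGraph.Subgraph)
    [Fintype G.verts] [Nonempty G.verts] {p : ℝ} (hp : 1 ≤ p)
    (hcard : 8 * (2 * L * ∏ t ∈ Finset.range (s + 1), Nat.card (Γ t) ^ (2 * L + 2 * D.k t)) ≤
      Fintype.card G.verts) :
    lpCheeger G.coe p ≤ 64 / L := by
  have hLR : (0 : ℝ) < L := by exact_mod_cast hL0
  have key : ∀ o : ℤ,
      Fintype.card G.verts ≤
        2 * ({v | (L : ℝ) / 2 ≤ tent L (D.pos v + o)} : Set G.verts).ncard →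
      lpCheeger G.coe p ≤ 64 / L := by
    intro o ho
    refine (lpCheeger_le_of_label hp (fun v : G.verts => D.label L o v)
      (fun v => (tent L (D.pos v + o) : ℝ)) (b := (L : ℝ) / 2) (by positivity) ?_ ?_ ?_ ?_
      ho).trans (le_of_eq (by field_simp; norm_num))
    · intro v
      exact_mod_cast tent_nonneg hL0 _
    · intro v w hvw
      exact_mod_cast (D.label_eq_or hL0 o (G.adj_sub hvw)).1
    · intro v w hvw
      exact_mod_cast (D.label_eq_or hL0 o (G.adj_sub hvw)).2
    · intro v
      obtain ⟨h1, h2⟩ := D.finite_and_ncard_label_le hL0 hL o (v : D.Delta)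
      refine le_trans (Nat.mul_le_mul_left 8 (le_trans ?_ h2)) hcard
      exact Set.ncard_le_ncard_of_injOn (fun w : G.verts => (w : D.Delta)) (fun w hw => hw)
        (fun w _ w' _ e => Subtype.ext e) h1
  -- The tents for the offsets `0` and `L` add up to `L`, so at each vertex one of them is at least
  -- `L / 2`, and one offset works for half of the vertices.
  have hunion : (Set.univ : Set G.verts) ⊆
      {v | (L : ℝ) / 2 ≤ tent L (D.pos v + 0)} ∪
        {v | (L : ℝ) / 2 ≤ tent L (D.pos v + L)} := by
    intro v _
    have h := tent_add_tent hL0 (D.pos v)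
    have h' : (tent L (D.pos v) : ℝ) + tent L (D.pos v + L) = L := by exact_mod_cast h
    rw [Set.mem_union, Set.mem_ofPred_eq, Set.mem_ofPred_eq, add_zero]
    by_contra! hc
    linarith [hc.1, hc.2]
  have hc := (Set.ncard_le_ncard hunion).trans (Set.ncard_union_le _ _)
  rw [Set.ncard_univ, Nat.card_eq_fintype_card] at hc
  rcases le_total ({v | (L : ℝ) / 2 ≤ tent L (D.pos v + 0)} : Set G.verts).ncard
    ({v | (L : ℝ) / 2 ≤ tent L (D.pos v + L)} : Set G.verts).ncard with h | h
  · exact key L (by omega)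
  · exact key 0 (by omega)

/-! ## Choice of the scale -/

/-- The scale is `⌊x / l s⌋` on the linear pieces of `varrho` and `k (s + 1)` on the constant ones.
The factor 2 pays for the floor of a number that is at least 1. -/
theorem exists_scale (D : LampData A B Γ) (hl : ∀ s, 1 ≤ D.l s) {x : ℝ} (hx : 1 ≤ D.varrho x) :
    D.varrho x ≤ x ∧ ∃ s L : ℕ, 0 < L ∧ D.k s ≤ L ∧ L ≤ D.k (s + 1) ∧
      D.varrho x ≤ 2 * L ∧ (L : ℝ) * D.l s ≤ x := by
  have hlR : ∀ s, (1 : ℝ) ≤ D.l s := fun s => by exact_mod_cast hl s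
  rw [varrho] at hx ⊢
  split_ifs at hx ⊢ with h h'
  · obtain ⟨h1, h2⟩ := h.choose_spec
    set s := h.choose
    have hl0 : (0 : ℝ) < D.l s := lt_of_lt_of_le one_pos (hlR s)
    have hx0 : 0 ≤ x := le_trans (by positivity) h1
    have hfl : (⌊x / D.l s⌋₊ : ℝ) ≤ x / D.l s := Nat.floor_le (by positivity)
    have hfl1 : 1 ≤ ⌊x / D.l s⌋₊ := Nat.le_floor (by exact_mod_cast hx)
    have hfl1' : (1 : ℝ) ≤ ⌊x / D.l s⌋₊ := by exact_mod_cast hfl1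
    refine ⟨div_le_self hx0 (hlR s), s, ⌊x / D.l s⌋₊, hfl1, Nat.le_floor ?_, ?_, ?_, ?_⟩
    · rwa [le_div_iff₀ hl0]
    · have : (⌊x / D.l s⌋₊ : ℝ) < D.k (s + 1) := lt_of_le_of_lt hfl (by rwa [div_lt_iff₀ hl0])
      exact_mod_cast this.le
    · linarith [Nat.lt_floor_add_one (x / D.l s)]
    · rwa [le_div_iff₀ hl0] at hfl
  · obtain ⟨h1, h2⟩ := h'.choose_spec
    set s := h'.choose
    have hk : 1 ≤ D.k (s + 1) := by exact_mod_cast hx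
    refine ⟨(le_mul_of_one_le_right (Nat.cast_nonneg _) (hlR s)).trans h1, s, D.k (s + 1), hk,
      D.k_monotone (Nat.le_succ s), le_rfl, by linarith, h1⟩
  · norm_num at hx

theorem sum_le_two_mul {l : ℕ → ℕ} (hl : ∀ s, 2 * l s ≤ l (s + 1)) (s : ℕ) :
    ∑ t ∈ Finset.range (s + 1), l t ≤ 2 * l s := by
  induction s with
  | zero => simp; omega
  | succ s ih =>
    rw [Finset.sum_range_succ]
    have := hl s
    omega

/-- The exponent is `9 = 8 + 1`: each level contributes `l t * (2L + 2 k t) ≤ 4 L * l t`, the `l t`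
sum to at most `2 * l s`, and the factor `2 * L` costs one more `L * l s`. -/
theorem piece_card_le [Finite A] [Finite B] (D : LampData A B Γ)
    (hdiam : ∀ s, (D.lampCayley s).ediam ≠ ⊤) (hl1 : ∀ s, 1 ≤ D.l s)
    (hl : ∀ s, 2 * D.l s ≤ D.l (s + 1)) {K : ℕ} (hK : 4 ≤ K) (hABK : Nat.card A + Nat.card B ≤ K)
    {s L : ℕ} (hkL : D.k s ≤ L) :
    2 * L * ∏ t ∈ Finset.range (s + 1), Nat.card (Γ t) ^ (2 * L + 2 * D.k t) ≤
      K ^ (9 * (L * D.l s)) := by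
  have h1 : ∏ t ∈ Finset.range (s + 1), Nat.card (Γ t) ^ (2 * L + 2 * D.k t) ≤
      K ^ (8 * (L * D.l s)) := by
    calc _ ≤ ∏ t ∈ Finset.range (s + 1), K ^ (D.l t * (4 * L)) := by
          refine Finset.prod_le_prod' fun t ht => ?_
          have hts : D.k t ≤ D.k s := D.k_monotone (Nat.lt_succ_iff.1 (Finset.mem_range.1 ht))
          calc _ ≤ (K ^ D.l t) ^ (2 * L + 2 * D.k t) :=
                Nat.pow_le_pow_left ((D.finite_and_card_le (hdiam t)).2.trans
                  (Nat.pow_le_pow_left hABK _)) _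
            _ = K ^ (D.l t * (2 * L + 2 * D.k t)) := (pow_mul _ _ _).symm
            _ ≤ _ := Nat.pow_le_pow_right (by omega) (Nat.mul_le_mul_left _ (by omega))
      _ = K ^ ((∑ t ∈ Finset.range (s + 1), D.l t) * (4 * L)) := by
          rw [Finset.prod_pow_eq_pow_sum, Finset.sum_mul]
      _ ≤ K ^ (2 * D.l s * (4 * L)) :=
          Nat.pow_le_pow_right (by omega) (Nat.mul_le_mul_right _ (sum_le_two_mul hl s))
      _ = _ := by ring_nf
  have h2 : 2 * L ≤ K ^ (L * D.l s) :=
    calc 2 * L ≤ 2 ^ (2 * L) := Nat.lt_two_pow_self.le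
      _ = 4 ^ L := by rw [pow_mul]; norm_num
      _ ≤ K ^ L := Nat.pow_le_pow_left hK _
      _ ≤ _ := Nat.pow_le_pow_right (by omega) (Nat.le_mul_of_pos_right _ (hl1 s))
  calc _ ≤ K ^ (L * D.l s) * K ^ (8 * (L * D.l s)) := Nat.mul_le_mul h2 h1
    _ = _ := by rw [← pow_add]; congr 1; ring

theorem one_le_l [Finite A] [Nontrivial A] (D : LampData A B Γ) {s : ℕ}
    (hdiam : (D.lampCayley s).ediam ≠ ⊤) : 1 ≤ D.l s := by
  have : Nontrivial (Γ s) := (D.a_injective s).nontrivial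
  exact Nat.one_le_iff_ne_zero.2 (SimpleGraph.diam_ne_zero_of_ediam_ne_top hdiam)

theorem ncard_mul_lpCheeger_le [Finite A] [Nontrivial A] [Finite B] (D : LampData A B Γ)
    (hdiam : ∀ s, (D.lampCayley s).ediam ≠ ⊤) (hl : ∀ s, 2 * D.l s ≤ D.l (s + 1)) {K : ℕ}
    (hK : 4 ≤ K) (hABK : Nat.card A + Nat.card B ≤ K) {p : ℝ} (hp : 1 ≤ p) {N : ℕ} (hN : 0 < N)
    (hρ : 0 < D.varrho (1 / (36 * Real.log K) * Real.log N))
    (G : D.cayleyGraph.Subgraph) [Fintype G.verts] (hG : Fintype.card G.verts ≤ N) :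
    (Fintype.card G.verts : ℝ) * lpCheeger G.coe p ≤
      128 * N / D.varrho (1 / (36 * Real.log K) * Real.log N) := by
  have hNR : (1 : ℝ) ≤ N := by exact_mod_cast hN
  have hGR : (Fintype.card G.verts : ℝ) ≤ N := by exact_mod_cast hG
  have hKR : (4 : ℝ) ≤ K := by exact_mod_cast hK
  have hlogK : 1 ≤ Real.log K := by
    rw [Real.le_log_iff_exp_le (by linarith)]
    linarith [Real.exp_one_lt_three]
  have hlogN : 0 ≤ Real.log N := Real.log_nonneg hNR
  set x := 1 / (36 * Real.log K) * Real.log N with hx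
  have hxN : 36 * Real.log K * x = Real.log N := by
    rw [hx]
    field_simp
  have h12 := lpCheeger_le_twelve G.coe hp
  rw [le_div_iff₀ hρ]
  rcases lt_or_ge (D.varrho x) 1 with h1 | h1
  · calc _ ≤ (Fintype.card G.verts : ℝ) * 12 * 1 := by gcongr
      _ ≤ _ := by linarith
  obtain ⟨hρx, s, L, hL0, hkL, hLk, hρL, hLx⟩ :=
    D.exists_scale (fun s => D.one_le_l (hdiam s)) h1
  have hx1 : 1 ≤ x := h1.trans hρx
  have hlogN36 : 36 * x ≤ Real.log N := by
    rw [← hxN]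
    nlinarith
  -- Here `r = N ^ (1/4)`. The constant `36 = 4 * 9` makes the bound of `piece_card_le` at most `r`,
  -- and the cut-off between small and large subgraphs is `r ^ 2 = √N`, which is at least `8 * r`.
  set r := Real.exp (Real.log N / 4) with hr
  have hrN : r ^ 2 * r ^ 2 = N := by
    rw [← pow_add, hr, ← Real.exp_nat_mul]
    norm_num
    rw [show (4 : ℝ) * (Real.log N / 4) = Real.log N by ring, Real.exp_log (by linarith)]
  have hrx : Real.log N / 4 + 1 ≤ r := Real.add_one_le_exp _
  have hr8 : 8 ≤ r := by linarith
  rcases lt_or_ge (Fintype.card G.verts : ℝ) (r ^ 2) with h2 | h2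
  -- For a small subgraph the universal bound is enough, since `varrho x ≤ x` is at most `√N`.
  · have hρr : D.varrho x ≤ r ^ 2 := by nlinarith
    calc _ ≤ (Fintype.card G.verts : ℝ) * 12 * D.varrho x := by gcongr
      _ ≤ r ^ 2 * 12 * r ^ 2 := by gcongr
      _ ≤ 128 * N := by rw [← hrN]; nlinarith [sq_nonneg (r ^ 2)]
  · have hn0 : (0 : ℝ) < Fintype.card G.verts := lt_of_lt_of_le (by positivity) h2
    have hne : Nonempty G.verts := Fintype.card_pos_iff.1 (by exact_mod_cast hn0)
    have hfin : ∀ s, Finite (Γ s) := fun s => (D.finite_and_card_le (hdiam s)).1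
    have hpc := D.piece_card_le hdiam (fun s => D.one_le_l (hdiam s)) hl hK hABK hkL
    have hKr : (K : ℝ) ^ (9 * (L * D.l s)) ≤ r := by
      rw [← Real.exp_log (show (0 : ℝ) < K by linarith), ← Real.exp_nat_mul, hr,
        Real.exp_le_exp, ← hxN]
      push_cast
      nlinarith
    have hcard : 8 * (2 * L * ∏ t ∈ Finset.range (s + 1),
        Nat.card (Γ t) ^ (2 * L + 2 * D.k t)) ≤ Fintype.card G.verts := by
      have h3 : (8 : ℝ) * (K ^ (9 * (L * D.l s)) : ℕ) ≤ Fintype.card G.verts := by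
        push_cast
        nlinarith
      exact (Nat.mul_le_mul_left 8 hpc).trans (by exact_mod_cast h3)
    have hL0R : (0 : ℝ) < L := by exact_mod_cast hL0
    have hch := D.lpCheeger_le_of_card hL0 hLk G hp hcard
    calc _ ≤ (Fintype.card G.verts : ℝ) * (64 / L) * D.varrho x := by gcongr
      _ ≤ (N : ℝ) * (64 / L) * (2 * L) := by gcongr
      _ = 128 * N := by field_simp; norm_num

end LampData

theorem mainTheorem11 (m₀ : ℝ) (hm₀ : 2 ≤ m₀) (d : ℕ) :
    ∃ c₁ c₂ : ℝ, 0 < c₁ ∧ 0 < c₂ ∧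
      ∀ (A : Type u) (B : Type v) (Γ : ℕ → Type w)
        [Group A] [Finite A] [Nontrivial A] [Group B] [Finite B] [Nontrivial B]
        [∀ s, Group (Γ s)] (D : LampData A B Γ),
        D.degree = d →
        (∀ s, (D.lampCayley s).ediam ≠ ⊤) →
        (∀ s, m₀ * (D.k s : ℝ) ≤ (D.k (s + 1) : ℝ)) →
        (∀ s, m₀ * (D.l s : ℝ) ≤ (D.l (s + 1) : ℝ)) →
        ∀ p : ℝ, 1 ≤ p → ∀ N : ℕ, 0 < N →
          poincareProfile D.cayleyGraph p N ≤
            ENNReal.ofReal (c₁ * N) / ENNReal.ofReal (D.varrho (c₂ * Real.log N)) := by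
  -- The base `K = 2d + 4` dominates `|A| + |B| ≤ 2d + 2` and is at least `4`, as `piece_card_le`
  -- requires.
  have hlog : 0 < Real.log (2 * d + 4 : ℕ) := Real.log_pos (by norm_cast; omega)
  refine ⟨128, 1 / (36 * Real.log (2 * d + 4 : ℕ)), by norm_num, by positivity, ?_⟩
  intro A B Γ _ _ _ _ _ _ _ D hdeg hdiam _ hl p hp N hN
  have hl2 : ∀ s, 2 * D.l s ≤ D.l (s + 1) := by
    intro s
    have h : (2 : ℝ) * D.l s ≤ D.l (s + 1) :=
      (mul_le_mul_of_nonneg_right hm₀ (Nat.cast_nonneg _)).trans (hl s)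
    exact_mod_cast h
  have hAB : Nat.card A + Nat.card B ≤ 2 * d + 4 := by
    have := D.card_add_card_le
    omega
  have hNR : (0 : ℝ) < N := by exact_mod_cast hN
  -- A vanishing denominator, as for `N = 1`, makes the right-hand side `⊤` because the numerator is
  -- positive.
  rcases le_or_gt (D.varrho (1 / (36 * Real.log (2 * d + 4 : ℕ)) * Real.log N)) 0 with hρ | hρ
  · rw [ENNReal.ofReal_of_nonpos hρ, ENNReal.div_zero]
    · exact le_top
    · rw [Ne, ENNReal.ofReal_eq_zero, not_le]
      positivity
  · refine iSup_le fun G => iSup_le fun hG => iSup_le fun hGN => ?_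
    let _ : Fintype G.verts := hG.fintype
    have hc : G.verts.ncard = Fintype.card G.verts := by
      rw [← Nat.card_coe_set_eq, Nat.card_eq_fintype_card]
    rw [← ENNReal.ofReal_div_of_pos hρ]
    refine ENNReal.ofReal_le_ofReal ?_
    rw [hc] at hGN ⊢
    exact D.ncard_mul_lpCheeger_le hdiam hl2 (by omega) hAB hp hN hρ G hGN
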